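/- **Theorem 2.1 (Optimality guarantee).** Let the environment index $\mathcal E$ be a random element of a Polish space $E$ and let $\mathrm{supp}(\mathcal E)\subseteq E$ be the support of its law. Let $(\Omega,\mathcal F)$ be a standard Borel space and, for $e\in E$, let $P^e$ be a probability measure on $\Omega$, measurable in $e$ (a Markov kernel). Let $X$ (with values in a measurable space $\mathcal X$) and $Y$ (with values in $\mathbb R^k$) be random variables on $\Omega$, and let $P$ be the pooled law, i.e. the mixture of the $P^e$ with respect to the law of $\mathcal E$. All maps below are measurable. Let $\Psi_S^*=\Psi_S^*(X)$ be a representation satisfying: * (Invariance) the conditional law $P^e(Y\mid\Psi_S^*)$ is the same for all $e\in\mathrm{supp}(\mathcal E)$: there is one Markov kernel that is a regular conditional distribution of $Y$ given $\Psi_S^*$ under every $P^e$, $e\in\mathrm{supp}(\mathcal E)$; * (Sufficiency) $Y=f(\Psi_S^*)+\epsilon$ for some function $f$ and some random variable $\epsilon$ independent of $X$, under $P$. **(1)** $\Psi_S^*$ is the maximal invariant predictor: it belongs to the invariance set $\mathcal I_{\mathcal E}=\{\Phi(X): Y\perp\mathcal E\mid\Phi(X)\}$, where the joint law of $(\mathcal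 E,X,Y)$ is obtained by drawing $\mathcal E$ and then $(X,Y)$ from $P^{\mathcal E}$, and $I(Y;\Phi)\le I(Y;\Psi_S^*)$ for every $\Phi\in\mathcal I_{\mathcal E}$, where $I\in[0,\infty]$ is the Shannon mutual information under $P$. **(2)** Assume that $Y$ is integrable under $P^e$ for every $e\in\mathrm{supp}(\mathcal E)$. Then there is a function $h^*(X)=m(\Psi_S^*)$ that is a version of $\mathbb E[Y\mid\Psi_S^*]$ under every $P^e$, $e\in\mathrm{supp}(\mathcal E)$. Suppose moreover the following. * (Heterogeneity) There is a random variable $\Psi_V$ such that $X$ is a function of $(\Psi_S^*,\Psi_V)$, almost surely under each $P^e$, $e\in\mathrm{supp}(\mathcal E)$, and the conditional law of $Y$ given $\Psi_V$ can change arbitrarily across environments while the law of $(\Psi_S^*,Y)$ is kept: for every $e\in\mathrm{supp}(\mathcal E)$, every probability law $Q$ for $\Psi_V$ and every Markov kernel $K$ with $\int K(v,\cdot)\,Q(dv)=P^e(Y\in\cdot)$, there is $e'\in\mathrm{supp}(\mathcal E)$ such that $(\Psi_S^*,Y)$ has the same law under $P^{e'}$ as under $P^e$, while under $P^{e'}$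 the variable $\Psi_V$ has law $Q$ and $Y$ has conditional law $K(v,\cdot)$ given $\Psi_V=v$. Let $g:\mathbb R^k\to\mathbb R$ be strictly convex and differentiable, with Bregman loss $D(z,y)=g(y)-g(z)-\langle\nabla g(z),y-z\rangle\ge 0$ for the prediction $z$ and the target $y$. Then every such $h^*$ minimizes the worst-case risk over all measurable $h:\mathcal X\to\mathbb R^k$: $$\sup_{e\in\mathrm{supp}(\mathcal E)}\mathbb E[D(h^*(X),Y)\mid e]\;\le\;\sup_{e\in\mathrm{supp}(\mathcal E)}\mathbb E[D(h(X),Y)\mid e]\qquad\text{(values in }[0,\infty]).$$ -/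

import Mathlib

universe w

open MeasureTheory ProbabilityTheory
open scoped ENNReal

/-- A family of environments. The environment index `ℰ` is a random element of `E` with law
`envLaw`; in environment `e` the sample point of `Ω` has law `law e`. The covariate `X` and the
target `Y` (with values in `ℝᵏ`) are random variables on `Ω`. -/
structure EnvModel (E Ω 𝒳 : Type*) [MeasurableSpace E] [MeasurableSpace Ω]
    [MeasurableSpace 𝒳] (k : ℕ) where
  envLaw : Measure E
  envLaw_prob : IsProbabilityMeasure envLaw
  law : Kernel E Ω
  law_markov : IsMarkovKernel law
  X : Ω → 𝒳
  measurable_X : Measurable X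
  Y : Ω → EuclideanSpace ℝ (Fin k)
  measurable_Y : Measurable Y

attribute [instance] EnvModel.envLaw_prob EnvModel.law_markov

namespace EnvModel

section Basic

variable {E Ω 𝒳 S : Type*} [MeasurableSpace E] [MeasurableSpace Ω] [MeasurableSpace 𝒳]
  [MeasurableSpace S] {k : ℕ} (M : EnvModel E Ω 𝒳 k)

/-- `supp(ℰ)`: the topological support of the law of the environment index. -/
def supp [TopologicalSpace E] : Set E := M.envLaw.support

/-- The joint law of `(ℰ, ω)`. -/
noncomputable def jointLaw : Measure (E × Ω) := M.envLaw ⊗ₘ M.law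

instance : IsProbabilityMeasure M.jointLaw := by
  unfold jointLaw; infer_instance

/-- The pooled law of the data: the mixture of the `law e` with respect to the law of `ℰ`. -/
noncomputable def pooledLaw : Measure Ω := M.law ∘ₘ M.envLaw

/-- Shannon mutual information `I(Y; Φ(X))` (in nats, under the pooled law): the Kullback-Leibler
divergence of the joint law from the product of the marginals. -/
noncomputable def mutualInfo (Φ : 𝒳 → S) : ℝ≥0∞ :=
  InformationTheory.klDiv (M.pooledLaw.map fun ω => (M.Y ω, Φ (M.X ω)))
    ((M.pooledLaw.map M.Y).prod (M.pooledLaw.map fun ω => Φ (M.X ω)))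

/-- Invariance: the conditional law of `Y` given `Ψ(X)` is the same in all environments of the
support, i.e. one Markov kernel is a regular conditional distribution of `Y` given `Ψ(X)` in each
of them. -/
def Invariance [TopologicalSpace E] (Ψ : 𝒳 → S) : Prop :=
  ∃ κ : Kernel S (EuclideanSpace ℝ (Fin k)), IsMarkovKernel κ ∧
    ∀ e ∈ M.supp, (M.law e).map (fun ω => (Ψ (M.X ω), M.Y ω)) =
      ((M.law e).map fun ω => Ψ (M.X ω)) ⊗ₘ κ

/-- Sufficiency: `Y = f(Ψ(X)) + ε` with `ε` independent of `X` (under the pooled law). -/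
def Sufficiency (Ψ : 𝒳 → S) : Prop :=
  ∃ (f : S → EuclideanSpace ℝ (Fin k)) (ε : Ω → EuclideanSpace ℝ (Fin k)),
    Measurable f ∧ Measurable ε ∧
    (∀ᵐ ω ∂M.pooledLaw, M.Y ω = f (Ψ (M.X ω)) + ε ω) ∧ IndepFun ε M.X M.pooledLaw

/-- Heterogeneity: `X` is a function of `Ψ(X)` and of a complementary (variant) random variable
`ΨV` with values in `V`, and the conditional law of `Y` given `ΨV` can change arbitrarily across
environments while the law of `(Ψ(X), Y)` is kept: starting from an environment `e`, every law `Q`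
of `ΨV` and every conditional law `K` of `Y` given `ΨV` that are compatible with the law of `Y` in
`e` are realized in some environment `e'`. -/
def Heterogeneity [TopologicalSpace E] (Ψ : 𝒳 → S) (V : Type*) [MeasurableSpace V] : Prop :=
  ∃ (ΨV : Ω → V) (H : S × V → 𝒳), Measurable ΨV ∧ Measurable H ∧
    (∀ e ∈ M.supp, ∀ᵐ ω ∂M.law e, M.X ω = H (Ψ (M.X ω), ΨV ω)) ∧
    ∀ e ∈ M.supp, ∀ (Q : Measure V) (K : Kernel V (EuclideanSpace ℝ (Fin k))),
      IsProbabilityMeasure Q → IsMarkovKernel K → K ∘ₘ Q = (M.law e).map M.Y →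
      ∃ e' ∈ M.supp,
        (M.law e').map (fun ω => (Ψ (M.X ω), M.Y ω)) =
          (M.law e).map (fun ω => (Ψ (M.X ω), M.Y ω)) ∧
        (M.law e').map (fun ω => (ΨV ω, M.Y ω)) = Q ⊗ₘ K

/-- `m(Ψ(X))` is (a version of) `E[Y | Ψ(X)]` in every environment of the support. -/
def IsCondMean [TopologicalSpace E] (Ψ : 𝒳 → S) (m : S → EuclideanSpace ℝ (Fin k)) : Prop :=
  Measurable m ∧ ∀ e ∈ M.supp,
    (fun ω => m (Ψ (M.X ω))) =ᵐ[M.law e]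
      (M.law e)[M.Y | MeasurableSpace.comap (fun ω => Ψ (M.X ω)) inferInstance]

end Basic

section MIP

variable {E Ω 𝒳 : Type*} [MeasurableSpace E] [StandardBorelSpace E]
  [MeasurableSpace Ω] [StandardBorelSpace Ω] [MeasurableSpace 𝒳] {k : ℕ} (M : EnvModel E Ω 𝒳 k)

/-- The invariance set: the representations `Φ(X)`, with values in `T`, such that `Y` and `ℰ` are
conditionally independent given `Φ(X)`. -/
def invarianceSet (T : Type*) [MeasurableSpace T] : Set (𝒳 → T) :=
  {Φ | ∃ hΦ : Measurable Φ,
    CondIndepFun (MeasurableSpace.comap (fun p : E × Ω => Φ (M.X p.2)) inferInstance)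
      ((hΦ.comp (M.measurable_X.comp measurable_snd)).comap_le)
      (fun p : E × Ω => M.Y p.2) (fun p : E × Ω => p.1) M.jointLaw}

/-- `Ψ` is a maximal invariant predictor: it maximizes `I(Y; Φ(X))` over all representations
(with values in any measurable space) in the invariance set. -/
def IsMaximalInvariantPredictor {S : Type*} [MeasurableSpace S] (Ψ : 𝒳 → S) : Prop :=
  Ψ ∈ M.invarianceSet S ∧
    ∀ (T : Type w) [MeasurableSpace T], ∀ Φ ∈ M.invarianceSet T,
      M.mutualInfo Φ ≤ M.mutualInfo Ψ

end MIP

end EnvModel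

/-- The Bregman loss generated by `g` of predicting `z` when the target is `y`:
`g y - g z - ⟨∇ g z, y - z⟩`. -/
noncomputable def bregmanLoss {k : ℕ} (g : EuclideanSpace ℝ (Fin k) → ℝ)
    (z y : EuclideanSpace ℝ (Fin k)) : ℝ :=
  g y - g z - fderiv ℝ g z (y - z)

/-- Worst-case risk `sup_{e ∈ supp ℰ} E[D(h(X), Y) | e]` in `[0, ∞]`; the Bregman loss of a convex
function is nonnegative, so the expectation always makes sense there. -/
noncomputable def EnvModel.worstCaseRisk {E Ω 𝒳 : Type*} [TopologicalSpace E] [MeasurableSpace E]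
    [MeasurableSpace Ω] [MeasurableSpace 𝒳] {k : ℕ} (M : EnvModel E Ω 𝒳 k)
    (g : EuclideanSpace ℝ (Fin k) → ℝ) (h : 𝒳 → EuclideanSpace ℝ (Fin k)) : ℝ≥0∞ :=
  ⨆ e ∈ M.supp, ∫⁻ ω, ENNReal.ofReal (bregmanLoss g (h (M.X ω)) (M.Y ω)) ∂(M.law e)

/-! Maximality: one kernel `κ` serves as the conditional law of `Y` given `Ψ(X)` throughout the
support. Mixing over environments, `κ` is also the conditional law given `(Ψ(X), ℰ)`, which is the
required conditional independence. Sufficiency makes the law of `Y` given `X` a function of `Ψ(X)`,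
so `Ψ(X)` carries all the information of `X` on `Y`, and data processing gives `I(Y; Φ) ≤ I(Y; X) ≤
I(Y; Ψ)` (`klDiv_compProd_comap_le`, `Sufficiency.mutualInfo_le`).

Risk: the mean of `κ` is the common conditional expectation, and a mean is the best constant under a
Bregman loss, so in each environment `m ∘ Ψ` is the best predictor built on `Ψ(X)`. Given a rival
`h` and an environment `e`, heterogeneity supplies `e'` with the same law of `(Ψ(X), Y)` but with
`ΨV` frozen at a point. There `h(X)` is a function of `Ψ(X)` alone, so its risk in `e'` is at least
that of `m ∘ Ψ` in `e` (`worstCaseRisk_condMean_le`). -/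

/-- The gradient inequality for a differentiable convex function. -/
theorem ConvexOn.add_fderiv_le {F : Type*} [NormedAddCommGroup F] [NormedSpace ℝ F] {g : F → ℝ}
    (hg : ConvexOn ℝ Set.univ g) {z : F} (hd : DifferentiableAt ℝ g z) (y : F) :
    g z + fderiv ℝ g z (y - z) ≤ g y := by
  -- On the line through `z` and `y`, the derivative at `0` is at most the chord slope over `[0,
  -- 1]`.
  have hconv : ConvexOn ℝ Set.univ (g ∘ AffineMap.lineMap (k := ℝ) z y) := by
    simpa using hg.comp_affineMap (AffineMap.lineMap (k := ℝ) z y)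
  have hder : HasDerivAt (g ∘ AffineMap.lineMap (k := ℝ) z y) (fderiv ℝ g z (y - z)) 0 := by
    have h : HasFDerivAt g (fderiv ℝ g z) (AffineMap.lineMap (k := ℝ) z y (0 : ℝ)) := by
      simpa using hd.hasFDerivAt
    exact h.comp_hasDerivAt (0 : ℝ) AffineMap.hasDerivAt_lineMap
  have := hconv.le_slope_of_hasDerivAt (Set.mem_univ _) (Set.mem_univ _) zero_lt_one hder
  simp [slope_def_field] at this
  simp only [map_sub]
  linarith

/-! ### Bregman losses and the optimality of the mean -/

section Bregman

variable {k : ℕ} {g : EuclideanSpace ℝ (Fin k) → ℝ}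

theorem bregmanLoss_nonneg (hg : ConvexOn ℝ Set.univ g) (hd : Differentiable ℝ g)
    (z y : EuclideanSpace ℝ (Fin k)) : 0 ≤ bregmanLoss g z y := by
  have := hg.add_fderiv_le (hd z) y
  unfold bregmanLoss
  linarith

theorem measurable_bregmanLoss (hd : Differentiable ℝ g) :
    Measurable fun p : EuclideanSpace ℝ (Fin k) × EuclideanSpace ℝ (Fin k) =>
      bregmanLoss g p.1 p.2 := by
  have hgm : Measurable g := hd.continuous.measurable
  have happ : Measurable fun p : (EuclideanSpace ℝ (Fin k) →L[ℝ] ℝ) × EuclideanSpace ℝ (Fin k) =>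
      p.1 p.2 := (isBoundedBilinearMap_apply (𝕜 := ℝ)).continuous.measurable
  have hf : Measurable (fderiv ℝ g) := measurable_fderiv ℝ g
  exact ((hgm.comp measurable_snd).sub (hgm.comp measurable_fst)).sub
    (happ.comp ((hf.comp measurable_fst).prodMk (measurable_snd.sub measurable_fst)))

/-- The mean minimizes the expected Bregman loss among constant predictions. -/
theorem lintegral_bregmanLoss_mean_le (hg : ConvexOn ℝ Set.univ g) (hd : Differentiable ℝ g)
    (ρ : Measure (EuclideanSpace ℝ (Fin k))) [IsProbabilityMeasure ρ]
    (hρ : Integrable (fun y => y) ρ) (z : EuclideanSpace ℝ (Fin k)) :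
    ∫⁻ y, ENNReal.ofReal (bregmanLoss g (∫ x, x ∂ρ) y) ∂ρ ≤
      ∫⁻ y, ENNReal.ofReal (bregmanLoss g z y) ∂ρ := by
  by_cases htop : ∫⁻ y, ENNReal.ofReal (bregmanLoss g z y) ∂ρ = ∞
  · simp [htop]
  set a := ∫ x, x ∂ρ with ha
  have hnn := bregmanLoss_nonneg hg hd
  have hint : Integrable (bregmanLoss g z) ρ :=
    (lintegral_ofReal_ne_top_iff_integrable
      ((measurable_bregmanLoss hd).comp (measurable_const.prodMk measurable_id)).aestronglyMeasurable
      (ae_of_all _ (hnn z))).1 htop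
  -- Three-point identity: `D(a, y) = D(z, y) + L (y - a) - D(z, a)`. The linear term has mean zero
  -- because `a` is the mean, and `D(z, a) ≥ 0` is dropped.
  set L : EuclideanSpace ℝ (Fin k) →L[ℝ] ℝ := fderiv ℝ g z - fderiv ℝ g a
  have hLint : Integrable (fun y => L (y - a)) ρ :=
    L.integrable_comp (hρ.sub (integrable_const a))
  have hL : ∫ y, L (y - a) ∂ρ = 0 := by
    have h := L.integral_comp_comm (φ := fun y => y - a) (hρ.sub (integrable_const a))
    rw [h, integral_sub hρ (integrable_const a)]
    simp [ha]
  have hle : ∀ y, bregmanLoss g a y ≤ bregmanLoss g z y + L (y - a) := by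
    intro y
    have := hnn z a
    simp only [bregmanLoss, L, map_sub, sub_apply] at this ⊢
    linarith
  calc ∫⁻ y, ENNReal.ofReal (bregmanLoss g a y) ∂ρ
      ≤ ∫⁻ y, ENNReal.ofReal (bregmanLoss g z y + L (y - a)) ∂ρ :=
        lintegral_mono fun y => ENNReal.ofReal_le_ofReal (hle y)
    _ = ENNReal.ofReal (∫ y, (bregmanLoss g z y + L (y - a)) ∂ρ) :=
        (ofReal_integral_eq_lintegral_ofReal (hint.add hLint)
          (ae_of_all _ fun y => (hnn a y).trans (hle y))).symm
    _ = ENNReal.ofReal (∫ y, bregmanLoss g z y ∂ρ) := by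
        rw [integral_add hint hLint, hL, add_zero]
    _ = ∫⁻ y, ENNReal.ofReal (bregmanLoss g z y) ∂ρ :=
        ofReal_integral_eq_lintegral_ofReal hint (ae_of_all _ (hnn z))

variable {S : Type*} [MeasurableSpace S]

/-- The conditional mean minimizes the expected Bregman loss among measurable predictors. -/
theorem lintegral_compProd_bregmanLoss_mean_le (hg : ConvexOn ℝ Set.univ g)
    (hd : Differentiable ℝ g) (μ : Measure S) [SFinite μ]
    (κ : Kernel S (EuclideanSpace ℝ (Fin k))) [IsMarkovKernel κ]
    (hint : Integrable (fun p : S × EuclideanSpace ℝ (Fin k) => p.2) (μ ⊗ₘ κ))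
    {h : S → EuclideanSpace ℝ (Fin k)} (hh : Measurable h) :
    ∫⁻ p, ENNReal.ofReal (bregmanLoss g (∫ x, x ∂κ p.1) p.2) ∂(μ ⊗ₘ κ) ≤
      ∫⁻ p, ENNReal.ofReal (bregmanLoss g (h p.1) p.2) ∂(μ ⊗ₘ κ) := by
  have hm : Measurable fun s => ∫ x, x ∂κ s :=
    (stronglyMeasurable_id.integral_kernel (κ := κ)).measurable
  have hb := measurable_bregmanLoss hd
  rw [Measure.lintegral_compProd, Measure.lintegral_compProd]
  · refine lintegral_mono_ae ?_
    filter_upwards [((Measure.integrable_compProd_iff measurable_snd.aestronglyMeasurable).1 hint).1]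
      with s hs
    exact lintegral_bregmanLoss_mean_le hg hd (κ s) hs (h s)
  · exact (hb.comp ((hh.comp measurable_fst).prodMk measurable_snd)).ennreal_ofReal
  · exact (hb.comp ((hm.comp measurable_fst).prodMk measurable_snd)).ennreal_ofReal

end Bregman

/-- If `κ` is a regular conditional distribution of `Y` given `Z`, then its mean is a version of the
conditional expectation of `Y` given `Z`. -/
theorem integral_kernel_ae_eq_condExp {Ω S F : Type*} {mΩ : MeasurableSpace Ω}
    [mS : MeasurableSpace S] [NormedAddCommGroup F] [NormedSpace ℝ F] [CompleteSpace F]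
    [MeasurableSpace F] [BorelSpace F] [SecondCountableTopology F]
    {P : Measure Ω} [IsFiniteMeasure P] {Z : Ω → S} {Y : Ω → F} (hZ : Measurable Z)
    (hY : Measurable Y) (hint : Integrable Y P) {κ : Kernel S F} [IsMarkovKernel κ]
    (hκ : P.map (fun ω => (Z ω, Y ω)) = P.map Z ⊗ₘ κ) :
    (fun ω => ∫ y, y ∂κ (Z ω)) =ᵐ[P] P[Y | mS.comap Z] := by
  have hm : StronglyMeasurable fun s => ∫ y, y ∂κ s := stronglyMeasurable_id.integral_kernel
  have hsnd : Integrable (fun p : S × F => p.2) (P.map Z ⊗ₘ κ) := by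
    rw [← hκ]
    exact (integrable_map_measure measurable_snd.aestronglyMeasurable
      (hZ.prodMk hY).aemeasurable).2 hint
  have hmint : Integrable (fun ω => ∫ y, y ∂κ (Z ω)) P :=
    (show Integrable (fun s => ∫ y, y ∂κ s) (P.map Z) from
      hsnd.integral_compProd).comp_measurable hZ
  refine ae_eq_condExp_of_forall_setIntegral_eq hZ.comap_le hint (fun s _ _ => hmint.integrableOn)
    ?_ (hm.comp_measurable (comap_measurable Z)).aestronglyMeasurable
  rintro _ ⟨s, hs, rfl⟩ -
  calc ∫ ω in Z ⁻¹' s, ∫ y, y ∂κ (Z ω) ∂P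
      = ∫ a in s, ∫ y, y ∂κ a ∂(P.map Z) :=
        (setIntegral_map hs hm.aestronglyMeasurable hZ.aemeasurable).symm
    _ = ∫ p in s ×ˢ Set.univ, p.2 ∂(P.map Z ⊗ₘ κ) := by
        rw [Measure.setIntegral_compProd hs MeasurableSet.univ hsnd.integrableOn]
        simp
    _ = ∫ ω in Z ⁻¹' s, Y ω ∂P := by
        rw [← hκ, setIntegral_map (hs.prod MeasurableSet.univ)
          measurable_snd.aestronglyMeasurable (hZ.prodMk hY).aemeasurable]
        congr 2
        ext; simp

/-- If the variable `W` has a Dirac law, then it can be replaced by a constant in any integral. -/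
theorem MeasureTheory.lintegral_prodMk_of_map_eq_dirac {Ω A V : Type*} [MeasurableSpace Ω] [MeasurableSpace A]
    [MeasurableSpace V] {P : Measure Ω} [IsProbabilityMeasure P] {Z : Ω → A} {W : Ω → V} {v : V}
    (hZ : Measurable Z) (hW : Measurable W) (hv : P.map W = Measure.dirac v) {φ : A × V → ℝ≥0∞}
    (hφ : Measurable φ) : ∫⁻ ω, φ (Z ω, W ω) ∂P = ∫⁻ ω, φ (Z ω, v) ∂P := by
  have hprod : P.map (fun ω => (Z ω, W ω)) = P.map fun ω => (Z ω, v) := by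
    refine Measure.ext_prod fun {s t} hs ht => ?_
    rw [Measure.map_apply (hZ.prodMk hW) (hs.prod ht),
      Measure.map_apply (hZ.prodMk measurable_const) (hs.prod ht)]
    have hWt : P (W ⁻¹' t) = t.indicator 1 v := by
      rw [← Measure.map_apply hW ht, hv, Measure.dirac_apply' v ht]
    by_cases hvt : v ∈ t
    · have hae : ∀ᵐ ω ∂P, W ω ∈ t := (prob_compl_eq_zero_iff (hW ht)).2 (by simp [hWt, hvt])
      refine measure_congr (Filter.eventuallyEq_set.2 ?_)
      filter_upwards [hae] with ω hω
      simp [hω, hvt]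
    · have h0 : P (W ⁻¹' t) = 0 := by simp [hWt, hvt]
      rw [measure_mono_null (fun ω hω => hω.2) h0, show (fun ω => (Z ω, v)) ⁻¹' s ×ˢ t = ∅ by
        ext; simp [hvt], measure_empty]
  rw [← lintegral_map hφ (hZ.prodMk hW), hprod, lintegral_map hφ (hZ.prodMk measurable_const)]

/-! ### Conditional means and worst-case risk -/

namespace EnvModel

section Risk

variable {E Ω 𝒳 S V : Type*} [MeasurableSpace E] [MeasurableSpace Ω] [MeasurableSpace 𝒳]
  [MeasurableSpace S] [MeasurableSpace V] {k : ℕ} {M : EnvModel E Ω 𝒳 k} [TopologicalSpace E]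
  {Ψ : 𝒳 → S}

theorem Invariance.exists_isCondMean (hinv : M.Invariance Ψ) (hΨ : Measurable Ψ)
    (hint : ∀ e ∈ M.supp, Integrable M.Y (M.law e)) : ∃ m, M.IsCondMean Ψ m := by
  obtain ⟨κ, _, hκ⟩ := hinv
  exact ⟨fun s => ∫ y, y ∂κ s, (stronglyMeasurable_id.integral_kernel (κ := κ)).measurable,
    fun e he => integral_kernel_ae_eq_condExp (hΨ.comp M.measurable_X) M.measurable_Y (hint e he)
      (hκ e he)⟩

theorem worstCaseRisk_condMean_le (hinv : M.Invariance Ψ) (hΨ : Measurable Ψ)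
    (hint : ∀ e ∈ M.supp, Integrable M.Y (M.law e)) (hhet : M.Heterogeneity Ψ V)
    {m : S → EuclideanSpace ℝ (Fin k)} (hm : M.IsCondMean Ψ m)
    {g : EuclideanSpace ℝ (Fin k) → ℝ} (hg : ConvexOn ℝ Set.univ g) (hd : Differentiable ℝ g)
    {h : 𝒳 → EuclideanSpace ℝ (Fin k)} (hh : Measurable h) :
    M.worstCaseRisk g (m ∘ Ψ) ≤ M.worstCaseRisk g h := by
  obtain ⟨κ, _, hκ⟩ := hinv
  obtain ⟨ΨV, H, hΨV, hH, hX, hrich⟩ := hhet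
  have hZ : Measurable fun ω => Ψ (M.X ω) := hΨ.comp M.measurable_X
  have hZY : Measurable fun ω => (Ψ (M.X ω), M.Y ω) := hZ.prodMk M.measurable_Y
  have hb := measurable_bregmanLoss hd
  refine iSup₂_le fun e he => ?_
  -- Any point of `V` would do; this only shows that one exists.
  obtain ⟨ω₀⟩ := (M.law e).nonempty_of_neZero
  set v := ΨV ω₀
  have hYprob : IsProbabilityMeasure ((M.law e).map M.Y) :=
    Measure.isProbabilityMeasure_map M.measurable_Y.aemeasurable
  -- A Dirac law with a constant kernel is compatible with the law of `Y` in `e`, and it makes `ΨV`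
  -- uninformative in `e'`.
  obtain ⟨e', he', hlaw, hlawV⟩ := hrich e he (Measure.dirac v)
    (Kernel.const V ((M.law e).map M.Y)) inferInstance inferInstance (by simp)
  have hdirac : (M.law e').map ΨV = Measure.dirac v := by
    rw [← Measure.fst_compProd (Measure.dirac v) (Kernel.const V ((M.law e).map M.Y)), ← hlawV,
      Measure.fst_map_prodMk M.measurable_Y]
  have hφ : Measurable fun p : (S × EuclideanSpace ℝ (Fin k)) × V =>
      ENNReal.ofReal (bregmanLoss g (h (H (p.1.1, p.2))) p.1.2) := by
    refine (hb.comp (Measurable.prodMk (hh.comp (hH.comp ?_)) ?_)).ennreal_ofReal <;> fun_prop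
  have hψ : Measurable fun p : S × EuclideanSpace ℝ (Fin k) =>
      ENNReal.ofReal (bregmanLoss g (h (H (p.1, v))) p.2) :=
    hφ.comp (measurable_id.prodMk measurable_const)
  have hm₀ : Measurable fun s => ∫ x, x ∂κ s :=
    (stronglyMeasurable_id.integral_kernel (κ := κ)).measurable
  have hintκ : Integrable (fun p : S × EuclideanSpace ℝ (Fin k) => p.2)
      ((M.law e).map (fun ω => Ψ (M.X ω)) ⊗ₘ κ) := by
    rw [← hκ e he]
    exact (integrable_map_measure measurable_snd.aestronglyMeasurable hZY.aemeasurable).2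
      (hint e he)
  calc ∫⁻ ω, ENNReal.ofReal (bregmanLoss g ((m ∘ Ψ) (M.X ω)) (M.Y ω)) ∂(M.law e)
      -- Two versions of the conditional expectation agree almost surely.
      = ∫⁻ ω, ENNReal.ofReal (bregmanLoss g (∫ x, x ∂κ (Ψ (M.X ω))) (M.Y ω)) ∂(M.law e) := by
        refine lintegral_congr_ae ?_
        filter_upwards [hm.2 e he, integral_kernel_ae_eq_condExp hZ M.measurable_Y (hint e he)
          (hκ e he)] with ω h₁ h₂
        rw [Function.comp_apply, h₁, h₂]
    _ = ∫⁻ p, ENNReal.ofReal (bregmanLoss g (∫ x, x ∂κ p.1) p.2)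
          ∂((M.law e).map (fun ω => Ψ (M.X ω)) ⊗ₘ κ) := by
        rw [← hκ e he, lintegral_map _ hZY]
        exact (hb.comp ((hm₀.comp measurable_fst).prodMk measurable_snd)).ennreal_ofReal
    _ ≤ ∫⁻ p, ENNReal.ofReal (bregmanLoss g (h (H (p.1, v))) p.2)
          ∂((M.law e).map (fun ω => Ψ (M.X ω)) ⊗ₘ κ) :=
        lintegral_compProd_bregmanLoss_mean_le hg hd _ κ hintκ
          (h := fun s => h (H (s, v))) (by fun_prop)
    _ = ∫⁻ ω, ENNReal.ofReal (bregmanLoss g (h (H (Ψ (M.X ω), v))) (M.Y ω)) ∂(M.law e') := by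
        rw [← hκ e he, ← hlaw, lintegral_map hψ hZY]
    _ = ∫⁻ ω, ENNReal.ofReal (bregmanLoss g (h (H (Ψ (M.X ω), ΨV ω))) (M.Y ω)) ∂(M.law e') :=
        (lintegral_prodMk_of_map_eq_dirac hZY hΨV hdirac hφ).symm
    _ = ∫⁻ ω, ENNReal.ofReal (bregmanLoss g (h (M.X ω)) (M.Y ω)) ∂(M.law e') := by
        refine lintegral_congr_ae ?_
        filter_upwards [hX e' he'] with ω hω
        rw [← hω]
    _ ≤ M.worstCaseRisk g h := le_iSup₂_of_le e' he' le_rfl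

end Risk

end EnvModel

/-! ### Joint densities and Kullback-Leibler divergence -/

section Density

variable {A S B : Type*} [MeasurableSpace A] [MeasurableSpace S] [MeasurableSpace B]

/-- If `κ` has the joint density `r` with respect to `ν`, then so has its pullback along `Ψ`. -/
theorem compProd_comap_eq_withDensity {P : Measure A} [IsFiniteMeasure P] {Ψ : A → S}
    (hΨ : Measurable Ψ) {κ : Kernel S B} [IsFiniteKernel κ] {ν : Measure B} [SFinite ν]
    {r : S × B → ℝ≥0∞} (hr : Measurable r)
    (h : P.map Ψ ⊗ₘ κ = ((P.map Ψ).prod ν).withDensity r) :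
    P ⊗ₘ κ.comap Ψ hΨ = (P.prod ν).withDensity (r ∘ Prod.map Ψ id) := by
  have hr' : Measurable (r ∘ Prod.map Ψ id) := hr.comp (hΨ.prodMap measurable_id)
  refine Measure.ext_prod fun {s t} hs ht => ?_
  -- The exceptional null set may depend on `t`; this is harmless, since measures are compared one
  -- rectangle at a time.
  have hae : (fun a => κ a t) =ᵐ[P.map Ψ] fun a => ∫⁻ b in t, r (a, b) ∂ν := by
    refine ae_eq_of_forall_setLIntegral_eq_of_sigmaFinite (κ.measurable_coe ht)
      hr.lintegral_prod_right' fun u hu _ => ?_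
    rw [← Measure.compProd_apply_prod hu ht, h, withDensity_apply _ (hu.prod ht),
      ← Measure.prod_restrict, lintegral_prod _ hr.aemeasurable]
  rw [Measure.compProd_apply_prod hs ht, withDensity_apply _ (hs.prod ht),
    ← Measure.prod_restrict, lintegral_prod _ hr'.aemeasurable]
  refine lintegral_congr_ae (ae_restrict_of_ae ?_)
  filter_upwards [ae_of_ae_map hΨ.aemeasurable hae] with a ha
  simpa using ha

open InformationTheory in
theorem klDiv_withDensity {ν : Measure A} [IsFiniteMeasure ν] {r : A → ℝ≥0∞} (hr : Measurable r)
    [IsFiniteMeasure (ν.withDensity r)] :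
    klDiv (ν.withDensity r) ν = ∫⁻ a, ENNReal.ofReal (klFun (r a).toReal) ∂ν := by
  rw [klDiv_eq_lintegral_klFun_of_ac (withDensity_absolutelyContinuous ν r)]
  refine lintegral_congr_ae ?_
  filter_upwards [Measure.rnDeriv_withDensity ν hr] with a ha
  rw [ha]

open InformationTheory in
/-- If the conditional law of the second variable depends on the first one only through `Ψ`, then
the first variable carries no more information on the second one than `Ψ` does. -/
theorem klDiv_compProd_comap_le {P : Measure A} [IsFiniteMeasure P] {Ψ : A → S}
    (hΨ : Measurable Ψ) {κ : Kernel S B} [IsFiniteKernel κ] {ν : Measure B} [IsFiniteMeasure ν] :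
    klDiv (P ⊗ₘ κ.comap Ψ hΨ) (P.prod ν) ≤ klDiv (P.map Ψ ⊗ₘ κ) ((P.map Ψ).prod ν) := by
  by_cases hac : P.map Ψ ⊗ₘ κ ≪ (P.map Ψ).prod ν
  swap
  · simp [klDiv_of_not_ac hac]
  set r := (P.map Ψ ⊗ₘ κ).rnDeriv ((P.map Ψ).prod ν)
  have hr : Measurable r := Measure.measurable_rnDeriv _ _
  have hrS : P.map Ψ ⊗ₘ κ = ((P.map Ψ).prod ν).withDensity r :=
    (Measure.withDensity_rnDeriv_eq _ _ hac).symm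
  have hrA := compProd_comap_eq_withDensity hΨ hr hrS
  have : IsFiniteMeasure (((P.map Ψ).prod ν).withDensity r) := hrS ▸ inferInstance
  have : IsFiniteMeasure ((P.prod ν).withDensity (r ∘ Prod.map Ψ id)) := hrA ▸ inferInstance
  have hprod : (P.map Ψ).prod ν = (P.prod ν).map (Prod.map Ψ id) := by
    conv_lhs => rw [← Measure.map_id (μ := ν)]
    exact Measure.map_prod_map P ν hΨ measurable_id
  -- Both divergences integrate `klFun` of the same density, once pulled back along `Ψ`, so a change
  -- of variables identifies them.
  rw [hrA, hrS, klDiv_withDensity hr, klDiv_withDensity (hr.comp (hΨ.prodMap measurable_id)),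
    hprod, lintegral_map (by fun_prop) (hΨ.prodMap measurable_id)]
  rfl

end Density

/-! ### Sufficiency and mutual information -/

namespace EnvModel

section Pooled

variable {E Ω 𝒳 S T : Type*} [MeasurableSpace E] [MeasurableSpace Ω] [MeasurableSpace 𝒳]
  [MeasurableSpace S] [MeasurableSpace T] {k : ℕ} {M : EnvModel E Ω 𝒳 k} {Ψ : 𝒳 → S}

instance : IsProbabilityMeasure M.pooledLaw := by
  unfold pooledLaw; infer_instance

/-- Under sufficiency the conditional law of `Y` given `X` depends on `X` only through `Ψ(X)`. -/
theorem Sufficiency.exists_kernel (hsuff : M.Sufficiency Ψ) (hΨ : Measurable Ψ) :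
    ∃ κ : Kernel S (EuclideanSpace ℝ (Fin k)), IsMarkovKernel κ ∧
      M.pooledLaw.map (fun ω => (M.X ω, M.Y ω)) = M.pooledLaw.map M.X ⊗ₘ κ.comap Ψ hΨ := by
  obtain ⟨f, ε, hf, hε, hY, hind⟩ := hsuff
  have hX := M.measurable_X
  have hεprob : IsProbabilityMeasure (M.pooledLaw.map ε) :=
    Measure.isProbabilityMeasure_map hε.aemeasurable
  have hadd : Measurable fun p : S × EuclideanSpace ℝ (Fin k) => f p.1 + p.2 := by fun_prop
  -- `κ s` is the law of `f s + ε`.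
  let κ : Kernel S (EuclideanSpace ℝ (Fin k)) :=
    (Kernel.id ×ₖ Kernel.const S (M.pooledLaw.map ε)).map fun p => f p.1 + p.2
  have hκapp : ∀ (s : S) {t : Set (EuclideanSpace ℝ (Fin k))}, MeasurableSet t →
      κ s t = M.pooledLaw.map ε ((f s + ·) ⁻¹' t) := by
    intro s t ht
    rw [Kernel.map_apply' _ hadd _ ht, Kernel.prod_apply, Kernel.id_apply, Kernel.const_apply,
      Measure.dirac_prod, Measure.map_apply measurable_prodMk_left (hadd ht)]
    rfl
  have hκ : IsMarkovKernel κ := Kernel.IsMarkovKernel.map _ hadd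
  refine ⟨κ, hκ, ?_⟩
  have hae : (fun ω => (M.X ω, M.Y ω)) =ᵐ[M.pooledLaw] fun ω => (M.X ω, f (Ψ (M.X ω)) + ε ω) := by
    filter_upwards [hY] with ω hω
    rw [hω]
  have hgm : Measurable fun p : 𝒳 × EuclideanSpace ℝ (Fin k) => (p.1, f (Ψ p.1) + p.2) := by
    fun_prop
  have hmap : M.pooledLaw.map (fun ω => (M.X ω, f (Ψ (M.X ω)) + ε ω)) =
      ((M.pooledLaw.map M.X).prod (M.pooledLaw.map ε)).map fun p => (p.1, f (Ψ p.1) + p.2) := by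
    rw [← (indepFun_iff_map_prod_eq_prod_map_map hX.aemeasurable hε.aemeasurable).1 hind.symm,
      Measure.map_map hgm (hX.prodMk hε)]
    rfl
  rw [Measure.map_congr hae, hmap]
  refine Measure.ext fun s hs => ?_
  rw [Measure.map_apply hgm hs, Measure.prod_apply (hgm hs), Measure.compProd_apply hs]
  refine lintegral_congr fun x => ?_
  rw [Kernel.comap_apply, hκapp _ (measurable_prodMk_left hs)]
  rfl

open InformationTheory in
-- Both sides are compared with the information carried by `X` itself: passing to `Φ(X)` can only
-- lose some, while passing to `Ψ(X)` loses none.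
theorem Sufficiency.mutualInfo_le (hsuff : M.Sufficiency Ψ) (hΨ : Measurable Ψ) {Φ : 𝒳 → T}
    (hΦ : Measurable Φ) : M.mutualInfo Φ ≤ M.mutualInfo Ψ := by
  obtain ⟨κ, hκ, hXY⟩ := hsuff.exists_kernel hΨ
  have hX := M.measurable_X
  have hY := M.measurable_Y
  set P := M.pooledLaw
  have hS : P.map (fun ω => Ψ (M.X ω)) = (P.map M.X).map Ψ := (Measure.map_map hΨ hX).symm
  have hSY : P.map (fun ω => (Ψ (M.X ω), M.Y ω)) = (P.map M.X).map Ψ ⊗ₘ κ := by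
    have : P.map (fun ω => (Ψ (M.X ω), M.Y ω)) =
        (P.map fun ω => (M.X ω, M.Y ω)).map (Prod.map Ψ id) := by
      rw [Measure.map_map (hΨ.prodMap measurable_id) (hX.prodMk hY)]; rfl
    rw [this, hXY]
    refine Measure.ext_prod fun {s t} hs ht => ?_
    rw [Measure.map_apply (hΨ.prodMap measurable_id) (hs.prod ht),
      Measure.compProd_apply_prod hs ht, setLIntegral_map hs (κ.measurable_coe ht) hΨ]
    exact Measure.compProd_apply_prod (hΨ hs) ht
  have hg : Measurable fun p : 𝒳 × EuclideanSpace ℝ (Fin k) => (p.2, Φ p.1) := by fun_prop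
  calc M.mutualInfo Φ
      = klDiv ((P.map fun ω => (M.X ω, M.Y ω)).map fun p => (p.2, Φ p.1))
          (((P.map M.X).prod (P.map M.Y)).map fun p => (p.2, Φ p.1)) := by
        rw [mutualInfo, Measure.map_map hg (hX.prodMk hY)]
        congr 1
        rw [show (fun p : 𝒳 × EuclideanSpace ℝ (Fin k) => (p.2, Φ p.1)) =
            Prod.swap ∘ Prod.map Φ id from rfl,
          ← Measure.map_map measurable_swap (hΦ.prodMap measurable_id),
          ← Measure.map_prod_map _ _ hΦ measurable_id, Measure.map_id, Measure.prod_swap,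
          Measure.map_map hΦ hX]
        rfl
    _ ≤ klDiv (P.map fun ω => (M.X ω, M.Y ω)) ((P.map M.X).prod (P.map M.Y)) :=
        klDiv_map_le _ _ hg
    _ ≤ klDiv (P.map fun ω => (Ψ (M.X ω), M.Y ω))
          ((P.map fun ω => Ψ (M.X ω)).prod (P.map M.Y)) := by
        rw [hXY, hSY, hS]
        exact klDiv_compProd_comap_le hΨ
    _ ≤ M.mutualInfo Ψ := by
        have hl : P.map (fun ω => (Ψ (M.X ω), M.Y ω)) =
            (P.map fun ω => (M.Y ω, Ψ (M.X ω))).map Prod.swap := by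
          exact (Measure.map_map measurable_swap (hY.prodMk (hΨ.comp hX))).symm
        rw [hl, ← Measure.prod_swap]
        exact klDiv_map_le _ _ measurable_swap

end Pooled

/-! ### From invariance to conditional independence -/

section Invariance

variable {E Ω 𝒳 S : Type*} [TopologicalSpace E] [MeasurableSpace E] [MeasurableSpace Ω]
  [MeasurableSpace 𝒳] [MeasurableSpace S] {k : ℕ} {M : EnvModel E Ω 𝒳 k} {Ψ : 𝒳 → S}

variable (M) in
-- The complement of the support is a union of null open sets, hence a countable one by the Lindelöf
-- property. Statements on the support thus pass to the mixture.
theorem ae_mem_supp [HereditarilyLindelofSpace E] : ∀ᵐ e ∂M.envLaw, e ∈ M.supp :=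
  Measure.support_mem_ae

theorem map_jointLaw_eq_compProd_prodMkRight [HereditarilyLindelofSpace E]
    {κ : Kernel S (EuclideanSpace ℝ (Fin k))} [IsMarkovKernel κ] (hΨ : Measurable Ψ)
    (hκ : ∀ e ∈ M.supp, (M.law e).map (fun ω => (Ψ (M.X ω), M.Y ω)) =
      ((M.law e).map fun ω => Ψ (M.X ω)) ⊗ₘ κ) :
    M.jointLaw.map (fun p => ((Ψ (M.X p.2), p.1), M.Y p.2)) =
      (M.jointLaw.map fun p => (Ψ (M.X p.2), p.1)) ⊗ₘ κ.prodMkRight E := by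
  have hX := M.measurable_X
  have hY := M.measurable_Y
  have hZ : Measurable fun ω => Ψ (M.X ω) := hΨ.comp hX
  refine Measure.ext fun s hs => ?_
  have hk : Measurable fun p : S × E => κ.prodMkRight E p (Prod.mk p ⁻¹' s) :=
    Kernel.measurable_kernel_prodMk_left hs
  have hZE : Measurable fun p : E × Ω => (Ψ (M.X p.2), p.1) := by fun_prop
  rw [Measure.map_apply (by fun_prop) hs, Measure.compProd_apply hs, jointLaw,
    Measure.compProd_apply (by measurability)]
  rw [lintegral_map hk hZE, Measure.lintegral_compProd (by exact hk.comp hZE)]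
  refine lintegral_congr_ae ?_
  filter_upwards [M.ae_mem_supp] with e he
  have hse : MeasurableSet ((fun q : S × EuclideanSpace ℝ (Fin k) => ((q.1, e), q.2)) ⁻¹' s) :=
    hs.preimage (by fun_prop)
  have h := congrArg (· ((fun q : S × EuclideanSpace ℝ (Fin k) => ((q.1, e), q.2)) ⁻¹' s)) (hκ e he)
  rw [Measure.map_apply (hZ.prodMk hY) hse, Measure.compProd_apply hse,
    lintegral_map (Kernel.measurable_kernel_prodMk_left hse) hZ] at h
  exact h

/-- The conditional laws of `Y` given `(Ψ(X), ℰ)` and given `Ψ(X)` are both `κ`, so `ℰ` adds nothing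
once `Ψ(X)` is known. -/
theorem Invariance.mem_invarianceSet [HereditarilyLindelofSpace E] [StandardBorelSpace E]
    [StandardBorelSpace Ω] (hinv : M.Invariance Ψ) (hΨ : Measurable Ψ) : Ψ ∈ M.invarianceSet S := by
  obtain ⟨κ, _, hκ⟩ := hinv
  have hX := M.measurable_X
  have hY := M.measurable_Y
  have hE : Nonempty E := M.envLaw.nonempty_of_neZero
  have hYj : Measurable fun p : E × Ω => M.Y p.2 := hY.comp measurable_snd
  have hZ : Measurable fun p : E × Ω => Ψ (M.X p.2) := hΨ.comp (hX.comp measurable_snd)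
  have hZE : Measurable fun p : E × Ω => (Ψ (M.X p.2), p.1) := hZ.prodMk measurable_fst
  have hjoint := map_jointLaw_eq_compProd_prodMkRight hΨ hκ
  have hmarg : M.jointLaw.map (fun p => (Ψ (M.X p.2), M.Y p.2)) =
      (M.jointLaw.map fun p => Ψ (M.X p.2)) ⊗ₘ κ := by
    refine Measure.ext_prod fun {s t} hs ht => ?_
    -- Leaving the environment unrestricted integrates it out.
    have h := congrArg (· ((s ×ˢ Set.univ) ×ˢ t)) hjoint
    rw [Measure.map_apply (hZE.prodMk hYj) ((hs.prod .univ).prod ht),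
      Measure.compProd_apply_prod (hs.prod .univ) ht,
      setLIntegral_map (hs.prod .univ) (Kernel.measurable_coe _ ht) hZE] at h
    rw [Measure.map_apply (hZ.prodMk hYj) (hs.prod ht), Measure.compProd_apply_prod hs ht,
      setLIntegral_map hs (Kernel.measurable_coe _ ht) hZ]
    convert h using 3
    · ext; simp
    · ext; simp
    · rfl
  refine ⟨hΨ, CondIndepFun.symm ?_⟩
  refine (condIndepFun_iff_condDistrib_prod_ae_eq_prodMkRight hYj measurable_fst hZ).2 ?_
  have h₁ := condDistrib_ae_eq_of_measure_eq_compProd_of_measurable hZE hYj hjoint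
  have h₂ := condDistrib_ae_eq_of_measure_eq_compProd_of_measurable hZ hYj hmarg
  have h₃ : ∀ᵐ q ∂(M.jointLaw.map fun p => (Ψ (M.X p.2), p.1)),
      condDistrib (fun p : E × Ω => M.Y p.2) (fun p => Ψ (M.X p.2)) M.jointLaw q.1 = κ q.1 := by
    refine ae_of_ae_map (f := Prod.fst) (p := fun s : S => condDistrib (fun p : E × Ω => M.Y p.2)
      (fun p => Ψ (M.X p.2)) M.jointLaw s = κ s) measurable_fst.aemeasurable ?_
    rw [Measure.map_map measurable_fst hZE]
    exact h₂
  filter_upwards [h₁, h₃] with q hq₁ hq₃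
  rw [hq₁, Kernel.prodMkRight_apply, Kernel.prodMkRight_apply, hq₃]

end Invariance

end EnvModel

theorem theorem2p1 {E Ω 𝒳 S V : Type*}
    [TopologicalSpace E] [PolishSpace E] [MeasurableSpace E] [BorelSpace E]
    [MeasurableSpace Ω] [StandardBorelSpace Ω] [MeasurableSpace 𝒳] [MeasurableSpace S]
    [MeasurableSpace V] {k : ℕ} (M : EnvModel E Ω 𝒳 k)
    (Ψ : 𝒳 → S) (hΨ : Measurable Ψ)
    (hinv : M.Invariance Ψ) (hsuff : M.Sufficiency Ψ) :
    EnvModel.IsMaximalInvariantPredictor.{w} M Ψ ∧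
    ((∀ e ∈ M.supp, Integrable M.Y (M.law e)) →
      (∃ m, M.IsCondMean Ψ m) ∧
      (M.Heterogeneity Ψ V →
        ∀ m, M.IsCondMean Ψ m →
        ∀ g : EuclideanSpace ℝ (Fin k) → ℝ, StrictConvexOn ℝ Set.univ g → Differentiable ℝ g →
          Measurable (m ∘ Ψ) ∧
          IsMinOn (M.worstCaseRisk g) {h | Measurable h} (m ∘ Ψ))) := by
  refine ⟨⟨hinv.mem_invarianceSet hΨ, fun T _ Φ hΦ => hsuff.mutualInfo_le hΨ hΦ.1⟩, fun hint =>
    ⟨hinv.exists_isCondMean hΨ hint, fun hhet m hm g hg hd => ⟨hm.1.comp hΨ, ?_⟩⟩⟩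
  exact isMinOn_iff.2 fun h hh =>
    EnvModel.worstCaseRisk_condMean_le hinv hΨ hint hhet hm hg.convexOn hd hh
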